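/- Let $D_X\in\mathbb{R}^{n\times n}$ and $D_Y\in\mathbb{R}^{m\times m}$ be symmetric matrices, let $\mu\in\mathbb{R}^n$, $\nu\in\mathbb{R}^m$ be probability vectors (nonnegative entries with sum $1$), and equip $\mathbb{R}^{n\times m}$ with the Frobenius inner product and norm. Put $$f(\pi)=-\mathrm{Tr}(D_X\pi D_Y\pi^T),\qquad C_1=\{\pi\ge 0:\pi\mathbf 1_m=\mu\},\qquad C_2=\{\pi\ge 0:\pi^T\mathbf 1_n=\nu\},$$ and let $$\mathcal X=\{\pi\in C_1\cap C_2:\ 0\in\nabla f(\pi)+\mathcal N_{C_1}(\pi)+\mathcal N_{C_2}(\pi)\}$$ be the critical point set of the Gromov–Wasserstein quadratic program $\min_{\pi\in C_1\cap C_2}f(\pi)$, where $\mathcal N_C(x)=\{p:\langle p,y-x\rangle\le 0\ \forall y\in C\}$ for $x\in C$ and $\mathcal N_C(x)=\emptyset$ for $x\notin C$ is the normal cone. Let $\sigma>0$. Then $\mathcal X\neq\emptyset$, and there are constants $\tau_1,\tau_2>0$, depending only on $D_X,D_Y,\mu,\nu$ and $\sigma$, such that the following holds. Let $h$ be a Legendre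 function on $\mathbb{R}^{n\times m}$ (a closed proper convex function, essentially smooth, and strictly convex on $\mathrm{int}(\mathrm{dom}\,h)$) that is $\sigma$-strongly convex on $\mathrm{int}(\mathrm{dom}\,h)\cap\mathrm{conv}(C_1\cup C_2)$, let $\rho>0$, and let $(\pi^\star,w^\star)$ be a fixed point of BAPG (the Bregman alternating projected gradient method), that is, $\pi^\star,w^\star\in\mathrm{int}(\mathrm{dom}\,h)$ and there are $p\in\mathcal N_{C_1}(\pi^\star)$ and $q\in\mathcal N_{C_2}(w^\star)$ with $$\nabla f(w^\star)+\rho\,(\nabla h(\pi^\star)-\nabla h(w^\star))+p=0,\qquad \nabla f(\pi^\star)+\rho\,(\nabla h(w^\star)-\nabla h(\pi^\star))+q=0 .$$ Then $$\|\pi^\star-w^\star\|\le\frac{\tau_1}{\rho}\qquad\text{and}\qquad \mathrm{dist}\Big(\frac{\pi^\star+w^\star}{2},\,\mathcal X\Big)\le\frac{\tau_2}{\rho}.$$ -/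

import Mathlib

open scoped Matrix Topology

namespace GromovWasserstein

/-- The space of real `n × m` matrices with the Frobenius inner product and norm. -/
abbrev MatSpace (n m : ℕ) : Type := EuclideanSpace ℝ (Fin n × Fin m)

/-- An element of `MatSpace n m`, read as a matrix. -/
def toMat {n m : ℕ} (π : MatSpace n m) : Matrix (Fin n) (Fin m) ℝ :=
  Matrix.of fun i j => π (i, j)

/-- The row-marginal constraint set `{π ≥ 0 : π 1_m = μ}`. -/
def C₁ {n m : ℕ} (μ : Fin n → ℝ) : Set (MatSpace n m) :=
  {π | (∀ i j, 0 ≤ toMat π i j) ∧ toMat π *ᵥ 1 = μ}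

/-- The column-marginal constraint set `{π ≥ 0 : πᵀ 1_n = ν}`. -/
def C₂ {n m : ℕ} (ν : Fin m → ℝ) : Set (MatSpace n m) :=
  {π | (∀ i j, 0 ≤ toMat π i j) ∧ (toMat π)ᵀ *ᵥ 1 = ν}

/-- The objective `f(π) = -Tr(D_X π D_Y πᵀ)`. -/
noncomputable def gwObjective {n m : ℕ} (DX : Matrix (Fin n) (Fin n) ℝ)
    (DY : Matrix (Fin m) (Fin m) ℝ) (π : MatSpace n m) : ℝ :=
  -(DX * toMat π * DY * (toMat π)ᵀ).trace

/-- The normal cone to `C` at `x` (empty when `x ∉ C`). -/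
def normalCone {E : Type*} [NormedAddCommGroup E] [InnerProductSpace ℝ E]
    (C : Set E) (x : E) : Set E :=
  {p | x ∈ C ∧ ∀ y ∈ C, inner ℝ p (y - x) ≤ 0}

/-- `h`, with effective domain `D` (and understood as `+∞` outside `D`), is a Legendre function:
a closed proper convex function that is essentially smooth, and strictly convex on the interior
of its domain. The values of `h` outside `D` are irrelevant. -/
structure IsLegendre {E : Type*} [NormedAddCommGroup E] [InnerProductSpace ℝ E] [CompleteSpace E]
    (D : Set E) (h : E → ℝ) : Prop where
  convexOn : ConvexOn ℝ D h
  isClosed_epigraph : IsClosed {z : E × ℝ | z.1 ∈ D ∧ h z.1 ≤ z.2}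
  interior_nonempty : (interior D).Nonempty
  differentiableAt : ∀ x ∈ interior D, DifferentiableAt ℝ h x
  gradient_blowup : ∀ (u : ℕ → E) (x : E), (∀ k, u k ∈ interior D) → x ∈ frontier D →
    Filter.Tendsto u Filter.atTop (𝓝 x) →
    Filter.Tendsto (fun k => ‖gradient h (u k)‖) Filter.atTop Filter.atTop
  strictConvexOn : StrictConvexOn ℝ (interior D) h

/-- The critical points of the minimization of `f` over `C₁ ∩ C₂`:
`π ∈ C₁ ∩ C₂` with `0 ∈ ∇f(π) + N_{C₁}(π) + N_{C₂}(π)`. -/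
def criticalSet {n m : ℕ} (DX : Matrix (Fin n) (Fin n) ℝ) (DY : Matrix (Fin m) (Fin m) ℝ)
    (μ : Fin n → ℝ) (ν : Fin m → ℝ) : Set (MatSpace n m) :=
  {π | π ∈ C₁ μ ∩ C₂ ν ∧ ∃ p ∈ normalCone (C₁ μ) π, ∃ q ∈ normalCone (C₂ ν) π,
    gradient (gwObjective DX DY) π + p + q = 0}

/-- The fixed points of the Bregman alternating projected gradient method with step size `ρ`
and Legendre function `h` with effective domain `D`; the points are taken in the interior of `D`,
where `∇h` exists. -/
def bapgFixedPoints {n m : ℕ} (DX : Matrix (Fin n) (Fin n) ℝ) (DY : Matrix (Fin m) (Fin m) ℝ)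
    (μ : Fin n → ℝ) (ν : Fin m → ℝ) (D : Set (MatSpace n m)) (h : MatSpace n m → ℝ) (ρ : ℝ) :
    Set (MatSpace n m × MatSpace n m) :=
  {z | z.1 ∈ interior D ∧ z.2 ∈ interior D ∧
    ∃ p ∈ normalCone (C₁ μ) z.1, ∃ q ∈ normalCone (C₂ ν) z.2,
      gradient (gwObjective DX DY) z.2 + ρ • (gradient h z.1 - gradient h z.2) + p = 0 ∧
      gradient (gwObjective DX DY) z.1 + ρ • (gradient h z.2 - gradient h z.1) + q = 0}

end GromovWasserstein

/-! The objective is a quadratic form, so its gradient is a linear map `T`. Adding the two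
fixed-point equations cancels `∇h` and leaves `T π + T w + p + q = 0`. Hence the midpoint, with
multipliers `p / 2` and `q / 2`, solves the critical point equation, and it violates the marginal
and complementarity conditions only by `O(‖π - w‖)`.

Fixing which coordinates vanish turns criticality into a linear system in the point and one
multiplier. The critical set is therefore a finite union of projected polyhedra, and Hoffman's error
bound for each pattern gives a critical point within `κ * ‖π - w‖` (`exists_critical_near`). An
inconsistent pattern admits no approximate solution below a threshold `δ`; larger distances are
covered by boundedness (`exists_critical_errorBound`).

For `‖π - w‖ = O(1/ρ)`, both normal cone inequalities are tested at a common `z ∈ C₁ ∩ C₂` with `‖z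
- π‖ + ‖z - w‖ = O(‖π - w‖)`. Their sum bounds `ρ * σ * ‖π - w‖ ^ 2` by a multiple of `‖π - w‖`
(`exists_norm_sub_le`). -/

namespace GromovWasserstein

/-! ### Hoffman's error bound for finite linear systems -/

/-- Error bounds for finite linear systems: every point violating the system by at most a small
`ε` is within `κ * ε` of a solution. In particular an inconsistent system cannot be solved
to arbitrary accuracy. -/
def HasLinearErrorBounds (V : Type*) [NormedAddCommGroup V] [NormedSpace ℝ V] : Prop :=
  ∀ (ι : Type) [Finite ι] (f : ι → V →L[ℝ] ℝ) (b : ι → ℝ),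
    ∃ δ κ : ℝ, 0 < δ ∧ 0 ≤ κ ∧ ∀ (x : V) (ε : ℝ), 0 ≤ ε → ε < δ → (∀ i, f i x ≤ b i + ε) →
      ∃ y, (∀ i, f i y ≤ b i) ∧ ‖x - y‖ ≤ κ * ε

lemma hasLinearErrorBounds_of_subsingleton (V : Type*) [NormedAddCommGroup V] [NormedSpace ℝ V]
    [Subsingleton V] : HasLinearErrorBounds V := by
  intro ι _ f b
  by_cases hb : ∀ i, 0 ≤ b i
  · refine ⟨1, 0, one_pos, le_rfl, fun x ε _ _ _ => ⟨x, fun i => ?_, by simp⟩⟩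
    rw [Subsingleton.elim x 0, map_zero]
    exact hb i
  · push Not at hb
    obtain ⟨i, hi⟩ := hb
    refine ⟨-b i, 0, by linarith, le_rfl, fun x ε _ hε h => ?_⟩
    have := h i
    rw [Subsingleton.elim x 0, map_zero] at this
    linarith

lemma HasLinearErrorBounds.of_equiv {V W : Type*} [NormedAddCommGroup V] [NormedSpace ℝ V]
    [NormedAddCommGroup W] [NormedSpace ℝ W] (hV : HasLinearErrorBounds V) (e : V ≃L[ℝ] W) :
    HasLinearErrorBounds W := by
  intro ι _ f b
  obtain ⟨δ, κ, hδ, hκ, H⟩ := hV ι (fun i => (f i).comp (e : V →L[ℝ] W)) b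
  refine ⟨δ, ‖(e : V →L[ℝ] W)‖ * κ, hδ, by positivity, fun x ε hε hεδ hx => ?_⟩
  obtain ⟨y, hy, hxy⟩ := H (e.symm x) ε hε hεδ (by simpa using hx)
  refine ⟨e y, by simpa using hy, ?_⟩
  have h1 := (e : V →L[ℝ] W).le_opNorm (e.symm x - y)
  simp only [map_sub, ContinuousLinearEquiv.coe_coe, ContinuousLinearEquiv.apply_symm_apply] at h1
  rw [mul_assoc]
  exact h1.trans (by gcongr)

/-- One step of Fourier–Motzkin elimination. -/
lemma HasLinearErrorBounds.prod_real {V : Type*} [NormedAddCommGroup V] [NormedSpace ℝ V]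
    (hV : HasLinearErrorBounds V) : HasLinearErrorBounds (V × ℝ) := by
  intro ι _ f b
  have := Fintype.ofFinite ι
  obtain ⟨g, hg⟩ : ∃ g : ι → V →L[ℝ] ℝ, ∀ i, g i = (f i).comp (ContinuousLinearMap.inl ℝ V ℝ) :=
    ⟨_, fun _ => rfl⟩
  obtain ⟨c, hc⟩ : ∃ c : ι → ℝ, ∀ i, c i = f i (0, 1) := ⟨_, fun _ => rfl⟩
  have hf : ∀ i x t, f i (x, t) = g i x + c i * t := by
    intro i x t
    have : ((x, t) : V × ℝ) = (x, 0) + t • (0, 1) := by simp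
    rw [this, map_add, map_smul, hg, hc, smul_eq_mul, mul_comm t]
    rfl
  -- The weights `-c j` and `c i` cancel the last coordinate. A violation `ε` of the original rows
  -- becomes at most `(c i - c j) * ε` here, which `C` dominates.
  obtain ⟨δ, κ, hδ, hκ, H⟩ := hV ({i // c i = 0} ⊕ ({i // 0 < c i} × {i // c i < 0}))
    (Sum.elim (fun i => g i) (fun ij => (-c ij.2) • g ij.1 + c ij.1 • g ij.2))
    (Sum.elim (fun i => b i) (fun ij => (-c ij.2) * b ij.1 + c ij.1 * b ij.2))
  set C : ℝ := 1 + 2 * ∑ i, |c i| with hC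
  have hcC : ∀ i j, c i - c j ≤ C := by
    intro i j
    have h1 := Finset.single_le_sum (f := fun i => |c i|) (fun i _ => abs_nonneg _)
      (Finset.mem_univ i)
    have h2 := Finset.single_le_sum (f := fun i => |c i|) (fun i _ => abs_nonneg _)
      (Finset.mem_univ j)
    have h3 := le_abs_self (c i)
    have h4 := neg_abs_le (c j)
    linarith
  have hC1 : 1 ≤ C := by
    have : 0 ≤ ∑ i, |c i| := Finset.sum_nonneg fun i _ => abs_nonneg _
    linarith
  have hC0 : 0 < C := by linarith
  -- Moving `x` to `y` costs at most `κ * C * ε`, so row `i` at `(y, t)` is violated by at most `K *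
  -- |c i| * ε`; shifting `t` by `K * ε` repairs it.
  set K : ℝ := ∑ i, (1 + ‖g i‖ * (κ * C)) / |c i| with hK
  have hK0 : ∀ i, 0 ≤ (1 + ‖g i‖ * (κ * C)) / |c i| := fun i => by positivity
  have hKi : ∀ i, c i ≠ 0 → 1 + ‖g i‖ * (κ * C) ≤ K * |c i| := by
    intro i hi
    rw [← div_le_iff₀ (abs_pos.mpr hi)]
    exact Finset.single_le_sum (f := fun i => (1 + ‖g i‖ * (κ * C)) / |c i|)
      (fun i _ => hK0 i) (Finset.mem_univ i)
  have hKnn : 0 ≤ K := Finset.sum_nonneg fun i _ => hK0 i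
  refine ⟨δ / C, κ * C + K, by positivity, by positivity, ?_⟩
  rintro ⟨x, t⟩ ε hε hεδ hx
  simp only [hf] at hx
  obtain ⟨y, hy, hxy⟩ := H x (C * ε) (by positivity) (by rwa [lt_div_iff₀' hC0] at hεδ) (by
    rintro (⟨i, hi⟩ | ⟨⟨i, hi⟩, ⟨j, hj⟩⟩)
    · have := hx i
      simp only [Sum.elim_inl]
      rw [hi] at this
      nlinarith
    · have h1 := mul_le_mul_of_nonneg_left (hx i) (neg_nonneg.mpr hj.le)
      have h2 := mul_le_mul_of_nonneg_left (hx j) hi.le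
      have h3 := mul_le_mul_of_nonneg_right (hcC i j) hε
      simp only [Sum.elim_inr, add_apply, smul_apply,
        smul_eq_mul]
      linarith)
  have hgy : ∀ i, c i ≠ 0 → g i y + c i * t ≤ b i + K * |c i| * ε := by
    intro i hi
    have h1 : |g i (y - x)| ≤ ‖g i‖ * (κ * (C * ε)) := by
      refine ((g i).le_opNorm _).trans ?_
      rw [norm_sub_rev]
      gcongr
    have h2 := (le_abs_self _).trans h1
    rw [map_sub] at h2
    have h3 := mul_le_mul_of_nonneg_right (hKi i hi) hε
    have := hx i
    linarith
  -- These are the lower bounds that the rows with `c j < 0` put on the last coordinate. The extra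
  -- element `t - K * ε` makes `S` nonempty and keeps the supremum near `t`; the paired rows put the
  -- supremum below every upper bound.
  set S : Set ℝ := insert (t - K * ε) ((fun j => (b j - g j y) / c j) '' {j | c j < 0}) with hS
  have hSne : S.Nonempty := ⟨_, Set.mem_insert _ _⟩
  have hSub : ∀ u, t - K * ε ≤ u → (∀ j, c j < 0 → (b j - g j y) / c j ≤ u) →
      u ∈ upperBounds S := by
    rintro u h1 h2 s (rfl | ⟨j, hj, rfl⟩)
    exacts [h1, h2 j hj]
  have hup : t + K * ε ∈ upperBounds S := by
    refine hSub _ (by nlinarith) fun j hj => ?_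
    have := hgy j hj.ne
    rw [abs_of_neg hj] at this
    rw [div_le_iff_of_neg hj]
    linarith
  have hSb : BddAbove S := ⟨_, hup⟩
  refine ⟨(y, sSup S), fun i => ?_, ?_⟩
  · rw [hf]
    rcases lt_trichotomy (c i) 0 with hi | hi | hi
    · have := le_csSup hSb (Set.mem_insert_of_mem _ ⟨i, hi, rfl⟩)
      rw [div_le_iff_of_neg hi] at this
      linarith
    · have := hy (Sum.inl ⟨i, hi⟩)
      simp only [Sum.elim_inl] at this
      rw [hi]
      linarith
    · have hu : sSup S ≤ (b i - g i y) / c i := by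
        refine csSup_le hSne (hSub _ ?_ fun j hj => ?_)
        · have := hgy i hi.ne'
          rw [abs_of_pos hi] at this
          rw [le_div_iff₀ hi]
          linarith
        · have := hy (Sum.inr ⟨⟨i, hi⟩, ⟨j, hj⟩⟩)
          simp only [Sum.elim_inr, add_apply, smul_apply,
            smul_eq_mul] at this
          rw [div_le_iff_of_neg hj, div_mul_eq_mul_div, div_le_iff₀ hi]
          linarith
      rw [le_div_iff₀ hi] at hu
      linarith
  · have h1 : sSup S ≤ t + K * ε := csSup_le hSne hup
    have h2 : t - K * ε ≤ sSup S := le_csSup hSb (Set.mem_insert _ _)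
    have h3 : |t - sSup S| ≤ K * ε := abs_le.mpr ⟨by linarith, by linarith⟩
    have h4 : 0 ≤ κ * C * ε := by positivity
    have h5 : 0 ≤ K * ε := by positivity
    rw [Prod.mk_sub_mk, Prod.norm_mk, Real.norm_eq_abs, add_mul]
    exact max_le (by linarith) (by linarith)

lemma hasLinearErrorBounds_of_finiteDimensional (V : Type*) [NormedAddCommGroup V]
    [NormedSpace ℝ V] [FiniteDimensional ℝ V] : HasLinearErrorBounds V := by
  have key : ∀ N : ℕ, HasLinearErrorBounds (Fin N → ℝ) := by
    intro N
    induction N with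
    | zero => exact hasLinearErrorBounds_of_subsingleton _
    | succ N ih =>
      refine ih.prod_real.of_equiv (ContinuousLinearEquiv.ofFinrankEq ?_)
      simp
  exact (key (Module.finrank ℝ V)).of_equiv (ContinuousLinearEquiv.ofFinrankEq (by simp))

/-! ### Products of simplices, their normal cones, and the local error bound -/

section FiberSimplex

variable {K ι ι' : Type} [Fintype K] [DecidableEq ι] [DecidableEq ι']

/-- The product of scaled simplices: nonnegative vectors indexed by `K` whose sum over the fibre of
`r` above `i` is `μ i`. -/
def fiberSimplex (r : K → ι) (μ : ι → ℝ) : Set (EuclideanSpace ℝ K) :=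
  {x | (∀ k, 0 ≤ x k) ∧ ∀ i, ∑ k with r k = i, x k = μ i}

/-- The sum of the coordinates in the fibre of `r` above `i`. -/
noncomputable def fiberSum (r : K → ι) (i : ι) : EuclideanSpace ℝ K →L[ℝ] ℝ :=
  ∑ k with r k = i, EuclideanSpace.proj k

lemma fiberSum_apply (r : K → ι) (i : ι) (x : EuclideanSpace ℝ K) :
    fiberSum r i x = ∑ k with r k = i, x k := by
  simp [fiberSum]

lemma convex_fiberSimplex (r : K → ι) (μ : ι → ℝ) : Convex ℝ (fiberSimplex r μ) := by
  rintro x ⟨hx, hx'⟩ y ⟨hy, hy'⟩ a b ha hb hab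
  refine ⟨fun k => ?_, fun i => ?_⟩
  · simp only [PiLp.add_apply, PiLp.smul_apply, smul_eq_mul]
    have := hx k
    have := hy k
    positivity
  · have h1 := hx' i
    have h2 := hy' i
    rw [← fiberSum_apply] at h1 h2 ⊢
    rw [map_add, map_smul, map_smul, h2, h1, smul_eq_mul, smul_eq_mul, ← add_mul, hab, one_mul]

lemma isClosed_fiberSimplex (r : K → ι) (μ : ι → ℝ) : IsClosed (fiberSimplex r μ) := by
  have : fiberSimplex r μ = (⋂ k, {x | 0 ≤ x k}) ∩ ⋂ i, {x | ∑ k with r k = i, x k = μ i} := by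
    ext x
    simp [fiberSimplex]
  rw [this]
  refine (isClosed_iInter fun k => isClosed_le ?_ ?_).inter
    (isClosed_iInter fun i => isClosed_eq ?_ ?_) <;> fun_prop

lemma fiberSimplex_apply_le {r : K → ι} {μ : ι → ℝ} {x : EuclideanSpace ℝ K}
    (hx : x ∈ fiberSimplex r μ) (k : K) : x k ≤ μ (r k) := by
  rw [← hx.2 (r k)]
  exact Finset.single_le_sum (f := fun k => x k) (fun k _ => hx.1 k) (by simp)

lemma norm_le_of_mem_fiberSimplex {r : K → ι} {μ : ι → ℝ} {x : EuclideanSpace ℝ K}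
    (hx : x ∈ fiberSimplex r μ) : ‖x‖ ≤ √(∑ k, μ (r k) ^ 2) := by
  rw [EuclideanSpace.norm_eq]
  gcongr with k
  rw [Real.norm_of_nonneg (hx.1 k)]
  exact fiberSimplex_apply_le hx k

lemma isCompact_fiberSimplex (r : K → ι) (μ : ι → ℝ) : IsCompact (fiberSimplex r μ) :=
  Metric.isCompact_of_isClosed_isBounded (isClosed_fiberSimplex r μ)
    (isBounded_iff_forall_norm_le.mpr ⟨_, fun _ => norm_le_of_mem_fiberSimplex⟩)

/-- The normal cone to a product of simplices: on each fibre the normal vector is maximal at every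
coordinate in the support. -/
lemma mem_normalCone_fiberSimplex {r : K → ι} {μ : ι → ℝ} {x p : EuclideanSpace ℝ K} :
    p ∈ normalCone (fiberSimplex r μ) x ↔
      x ∈ fiberSimplex r μ ∧ ∀ k k', r k = r k' → 0 < x k → p k' ≤ p k := by
  classical
  refine and_congr_right fun hx => ⟨fun h k k' hk hpos => ?_, fun h y hy => ?_⟩
  · rcases eq_or_ne k k' with rfl | hne
    · rfl
    -- Moving all the mass at `k` to `k'` stays in the set, so `x k * (p k' - p k) ≤ 0`.
    set v : EuclideanSpace ℝ K :=
      EuclideanSpace.single k' (x k) - EuclideanSpace.single k (x k) with hv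
    have hmem : x + v ∈ fiberSimplex r μ := by
      refine ⟨fun l => ?_, fun i => ?_⟩
      · have := hx.1 l
        simp only [hv, PiLp.add_apply, PiLp.sub_apply, PiLp.single_apply]
        split_ifs with h1 h2 h2
        · linarith
        · linarith
        · subst h2; linarith
        · linarith
      · rw [← fiberSum_apply, map_add, fiberSum_apply, hx.2 i, fiberSum_apply]
        simp only [hv, PiLp.sub_apply, PiLp.single_apply, Finset.sum_sub_distrib,
          Finset.sum_ite_eq', Finset.mem_filter, Finset.mem_univ, true_and, hk, sub_self, add_zero]
    have h1 := h _ hmem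
    rw [add_sub_cancel_left, hv, inner_sub_right, EuclideanSpace.inner_single_right,
      EuclideanSpace.inner_single_right] at h1
    simp only [conj_trivial] at h1
    rw [← mul_sub] at h1
    nlinarith
  · have hsplit : inner ℝ p (y - x)
        = ∑ i ∈ Finset.univ.image r, ∑ k with r k = i, p k * (y k - x k) := by
      rw [PiLp.inner_apply,
        ← Finset.sum_fiberwise_of_maps_to (s := Finset.univ) (t := Finset.univ.image r) (g := r)
          (fun k _ => Finset.mem_image_of_mem r (Finset.mem_univ k))]
      refine Finset.sum_congr rfl fun i _ => Finset.sum_congr rfl fun k _ => ?_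
      simp [mul_comm]
    rw [hsplit]
    -- On a fibre charged by `x`, `p` may be replaced by its maximum `p k₀`, and the two equal
    -- masses cancel. On any other fibre `μ i = 0`, so `y` vanishes as well.
    refine Finset.sum_nonpos fun i _ => ?_
    by_cases hi : ∃ k, r k = i ∧ 0 < x k
    · obtain ⟨k₀, rfl, hk₀⟩ := hi
      have hle : ∀ k ∈ Finset.univ.filter (fun k => r k = r k₀),
          p k * (y k - x k) ≤ p k₀ * (y k - x k) := by
        intro k hk
        have hk : r k = r k₀ := by simpa using hk
        have h1 := mul_le_mul_of_nonneg_right (h k₀ k hk.symm hk₀) (hy.1 k)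
        rcases (hx.1 k).eq_or_lt with h0 | h0
        · rw [← h0]; linarith
        · have : p k = p k₀ := le_antisymm (h k₀ k hk.symm hk₀) (h k k₀ hk h0)
          rw [this]
      refine (Finset.sum_le_sum hle).trans_eq ?_
      rw [← Finset.mul_sum, Finset.sum_sub_distrib, hx.2, hy.2, sub_self, mul_zero]
    · push Not at hi
      have hx0 : ∀ k, r k = i → x k = 0 := fun k hk => le_antisymm (hi k hk) (hx.1 k)
      have hμ : μ i = 0 := by
        rw [← hx.2 i]
        exact Finset.sum_eq_zero fun k hk => hx0 k (by simpa using hk)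
      refine (Finset.sum_eq_zero fun k hk => ?_).le
      have hk : r k = i := by simpa using hk
      have hyk : y k = 0 := le_antisymm ((fiberSimplex_apply_le hy k).trans_eq (by rw [hk, hμ]))
        (hy.1 k)
      rw [hyk, hx0 k hk, sub_self, mul_zero]

/-- The solutions of `0 ∈ T x + N₁(x) + N₂(x)`, where `N₁` and `N₂` are the normal cones of two
products of simplices. -/
def criticalPoints (r : K → ι) (s : K → ι') (μ : ι → ℝ) (ν : ι' → ℝ)
    (T : EuclideanSpace ℝ K →L[ℝ] EuclideanSpace ℝ K) : Set (EuclideanSpace ℝ K) :=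
  {x | ∃ p ∈ normalCone (fiberSimplex r μ) x, ∃ q ∈ normalCone (fiberSimplex s ν) x,
    T x + p + q = 0}

/-- The error bound for the linear system that describes the critical points `z`, with multiplier
`p`, for which `z` vanishes on `A ∪ B` and the first and second multipliers are maximal outside
`A` and `B` respectively. -/
lemma exists_errorBound_of_pattern [Finite ι] [Finite ι'] (r : K → ι) (s : K → ι')
    (μ : ι → ℝ) (ν : ι' → ℝ) (T : EuclideanSpace ℝ K →L[ℝ] EuclideanSpace ℝ K) (A B : Set K) :
    ∃ δ κ : ℝ, 0 < δ ∧ 0 ≤ κ ∧ ∀ (z p q : EuclideanSpace ℝ K) (ε : ℝ), 0 ≤ ε → ε < δ →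
      (∀ k, 0 ≤ z k) → (∀ i, |fiberSum r i z - μ i| ≤ ε) → (∀ i, |fiberSum s i z - ν i| ≤ ε) →
      (∀ k ∈ A ∪ B, z k ≤ ε) →
      (∀ k k', r k = r k' → k ∉ A → p k' ≤ p k) → (∀ k k', s k = s k' → k ∉ B → q k' ≤ q k) →
      T z + p + q = 0 →
      ∃ y ∈ criticalPoints r s μ ν T, ‖z - y‖ ≤ κ * ε := by
  -- The unknowns are `(z, p)`; the second multiplier is eliminated as `-T z - p`, which is `π₃`.
  -- Each equality is encoded as two opposite inequalities.
  let E := EuclideanSpace ℝ K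
  let π₁ : E × E →L[ℝ] E := ContinuousLinearMap.fst ℝ E E
  let π₂ : E × E →L[ℝ] E := ContinuousLinearMap.snd ℝ E E
  let π₃ : E × E →L[ℝ] E := -(T.comp π₁) - π₂
  let e (k : K) : E →L[ℝ] ℝ := EuclideanSpace.proj k
  obtain ⟨δ, κ, hδ, hκ, H⟩ := hasLinearErrorBounds_of_finiteDimensional (E × E)
    (K ⊕ ι ⊕ ι ⊕ ι' ⊕ ι' ⊕ ↥(A ∪ B) ⊕ {k : K × K // r k.1 = r k.2 ∧ k.1 ∉ A} ⊕
      {k : K × K // s k.1 = s k.2 ∧ k.1 ∉ B})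
    (Sum.elim (fun k => -(e k).comp π₁) <|
      Sum.elim (fun i => (fiberSum r i).comp π₁) <| Sum.elim (fun i => -(fiberSum r i).comp π₁) <|
      Sum.elim (fun i => (fiberSum s i).comp π₁) <| Sum.elim (fun i => -(fiberSum s i).comp π₁) <|
      Sum.elim (fun k => (e k).comp π₁) <|
      Sum.elim (fun k => (e k.1.2 - e k.1.1).comp π₂) fun k => (e k.1.2 - e k.1.1).comp π₃)
    (Sum.elim (fun _ => 0) <| Sum.elim μ <| Sum.elim (-μ) <| Sum.elim ν <| Sum.elim (-ν) fun _ => 0)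
  refine ⟨δ, κ, hδ, hκ, fun z p q ε hε hεδ hz hr hs hAB hA hB hT => ?_⟩
  have hq : -T z - p = q := by rw [sub_eq_iff_eq_add, neg_eq_iff_add_eq_zero, ← hT]; abel
  simp only [Sum.forall, Sum.elim_inl, Sum.elim_inr, Subtype.forall, Prod.forall, Pi.neg_apply]
    at H
  obtain ⟨⟨y, p'⟩, ⟨h1, h2, h3, h4, h5, h6, h7, h8⟩, hy⟩ := H z p ε hε hεδ (by
    refine ⟨fun k => ?_, fun i => ?_, fun i => ?_, fun i => ?_, fun i => ?_, fun k hk => ?_,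
      fun k k' h => ?_, fun k k' h => ?_⟩
    · have : -z k ≤ 0 + ε := by linarith [hz k]
      exact this
    · have : fiberSum r i z ≤ μ i + ε := by linarith [(abs_le.mp (hr i)).2]
      exact this
    · have : -fiberSum r i z ≤ -μ i + ε := by linarith [(abs_le.mp (hr i)).1]
      exact this
    · have : fiberSum s i z ≤ ν i + ε := by linarith [(abs_le.mp (hs i)).2]
      exact this
    · have : -fiberSum s i z ≤ -ν i + ε := by linarith [(abs_le.mp (hs i)).1]
      exact this
    · have : z k ≤ 0 + ε := by linarith [hAB k hk]
      exact this
    · have : p k' - p k ≤ 0 + ε := by linarith [hA k k' h.1 h.2]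
      exact this
    · have : (-T z - p) k' - (-T z - p) k ≤ 0 + ε := by
        rw [hq]
        linarith [hB k k' h.1 h.2]
      exact this)
  have hy0 : ∀ k, 0 ≤ y k := fun k => neg_nonpos.mp (h1 k)
  -- The solution may vanish at further coordinates, but its support avoids `A ∪ B`, so the
  -- maximality rows cover all of it.
  have hA0 : ∀ k, 0 < y k → k ∉ A ∪ B := fun k hk hk' => hk.not_ge (h6 k hk')
  refine ⟨y, ⟨p', mem_normalCone_fiberSimplex.mpr ⟨⟨hy0, fun i => ?_⟩, fun k k' hk hpos => ?_⟩,
    -T y - p', mem_normalCone_fiberSimplex.mpr ⟨⟨hy0, fun i => ?_⟩, fun k k' hk hpos => ?_⟩, ?_⟩,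
    (norm_fst_le _).trans hy⟩
  · rw [← fiberSum_apply]
    exact le_antisymm (h2 i) (neg_le_neg_iff.mp (h3 i))
  · exact sub_nonpos.mp (h7 k k' ⟨hk, fun h => hA0 k hpos (Or.inl h)⟩)
  · rw [← fiberSum_apply]
    exact le_antisymm (h4 i) (neg_le_neg_iff.mp (h5 i))
  · exact sub_nonpos.mp (h8 k k' ⟨hk, fun h => hA0 k hpos (Or.inr h)⟩)
  · abel

lemma smul_mem_normalCone {E : Type*} [NormedAddCommGroup E] [InnerProductSpace ℝ E] {C : Set E}
    {x p : E} (hp : p ∈ normalCone C x) {c : ℝ} (hc : 0 ≤ c) : c • p ∈ normalCone C x := by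
  refine ⟨hp.1, fun y hy => ?_⟩
  rw [real_inner_smul_left]
  exact mul_nonpos_of_nonneg_of_nonpos hc (hp.2 y hy)

/-- A pair of nearby points satisfying the critical point equation jointly is close to a critical
point. -/
lemma exists_critical_near [Finite ι] [Finite ι'] (r : K → ι) (s : K → ι')
    (μ : ι → ℝ) (ν : ι' → ℝ) (T : EuclideanSpace ℝ K →L[ℝ] EuclideanSpace ℝ K) :
    ∃ δ κ : ℝ, 0 < δ ∧ 0 ≤ κ ∧ ∀ x y p q : EuclideanSpace ℝ K,
      p ∈ normalCone (fiberSimplex r μ) x → q ∈ normalCone (fiberSimplex s ν) y →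
      T x + T y + p + q = 0 → ‖x - y‖ < δ →
      ∃ z ∈ criticalPoints r s μ ν T, ‖(1 / 2 : ℝ) • (x + y) - z‖ ≤ κ * ‖x - y‖ := by
  classical
  have := Fintype.ofFinite ι
  have := Fintype.ofFinite ι'
  choose δ κ hδ hκ H using exists_errorBound_of_pattern r s μ ν T
  -- There are finitely many patterns: the least `δ` and the sum of all `κ` serve them uniformly.
  obtain ⟨P, hP⟩ := Finite.exists_min fun P : Set K × Set K => δ P.1 P.2
  set C : ℝ := 1 + ∑ i, ‖fiberSum r i‖ + ∑ i, ‖fiberSum s i‖ with hC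
  have h1 : 0 ≤ ∑ i, ‖fiberSum r i‖ := Finset.sum_nonneg fun i _ => norm_nonneg _
  have h2 : 0 ≤ ∑ i, ‖fiberSum s i‖ := Finset.sum_nonneg fun i _ => norm_nonneg _
  have hr : ∀ i, ‖fiberSum r i‖ ≤ C := fun i => by
    have := Finset.single_le_sum (f := fun i => ‖fiberSum r i‖) (fun i _ => norm_nonneg _)
      (Finset.mem_univ i)
    linarith
  have hs : ∀ i, ‖fiberSum s i‖ ≤ C := fun i => by
    have := Finset.single_le_sum (f := fun i => ‖fiberSum s i‖) (fun i _ => norm_nonneg _)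
      (Finset.mem_univ i)
    linarith
  have hC1 : 1 ≤ C := by linarith
  have hC0 : 0 < C := by linarith
  refine ⟨δ P.1 P.2 / C, (∑ P : Set K × Set K, κ P.1 P.2) * C, div_pos (hδ _ _) hC0,
    mul_nonneg (Finset.sum_nonneg fun _ _ => hκ _ _) hC0.le, fun x y p q hp hq hT hxy => ?_⟩
  rw [lt_div_iff₀' hC0] at hxy
  have hp' := mem_normalCone_fiberSimplex.mp (smul_mem_normalCone hp one_half_pos.le)
  have hq' := mem_normalCone_fiberSimplex.mp (smul_mem_normalCone hq one_half_pos.le)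
  have hcoord : ∀ k, |(x - y) k| ≤ C * ‖x - y‖ := fun k =>
    (PiLp.norm_apply_le (x - y) k).trans (le_mul_of_one_le_left (norm_nonneg _) hC1)
  have hsum : ∀ f : EuclideanSpace ℝ K →L[ℝ] ℝ, ‖f‖ ≤ C → |f x - f y| ≤ C * ‖x - y‖ := by
    intro f hf
    rw [← map_sub]
    exact (f.le_opNorm _).trans (by gcongr)
  -- The pattern consists of the zero sets of `x` and `y`. The maximality conditions then hold
  -- exactly for the halved multipliers; only the marginals and the vanishing conditions are off, by
  -- at most `C * ‖x - y‖`.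
  obtain ⟨z, hz, hzle⟩ := H {k | x k = 0} {k | y k = 0} ((1 / 2 : ℝ) • (x + y)) _ _
    (C * ‖x - y‖) (by positivity) (hxy.trans_le (hP ({k | x k = 0}, {k | y k = 0})))
    (fun k => by
      have := hp'.1.1 k
      have := hq'.1.1 k
      simp only [PiLp.smul_apply, PiLp.add_apply, smul_eq_mul]
      positivity)
    (fun i => by
      have h3 := hsum _ (hr i)
      have h4 := hp'.1.2 i
      rw [← fiberSum_apply] at h4
      rw [h4] at h3
      rw [map_smul, map_add, h4, smul_eq_mul]
      have h5 : 1 / 2 * (μ i + fiberSum r i y) - μ i = -(1 / 2 * (μ i - fiberSum r i y)) := by ring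
      rw [h5, abs_neg, abs_mul, abs_of_pos one_half_pos]
      linarith [abs_nonneg (μ i - fiberSum r i y)])
    (fun i => by
      have h3 := hsum _ (hs i)
      have h4 := hq'.1.2 i
      rw [← fiberSum_apply] at h4
      rw [h4] at h3
      rw [map_smul, map_add, h4, smul_eq_mul]
      have h5 : 1 / 2 * (fiberSum s i x + ν i) - ν i = 1 / 2 * (fiberSum s i x - ν i) := by ring
      rw [h5, abs_mul, abs_of_pos one_half_pos]
      linarith [abs_nonneg (fiberSum s i x - ν i)])
    (fun k hk => by
      have h3 := abs_le.mp (hcoord k)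
      simp only [PiLp.sub_apply, PiLp.smul_apply, PiLp.add_apply, smul_eq_mul] at h3 ⊢
      have := hp'.1.1 k
      have := hq'.1.1 k
      rcases hk with hk | hk <;> rw [Set.mem_ofPred_eq] at hk <;> rw [hk] at h3 ⊢ <;> linarith)
    (fun k k' hk hne => hp'.2 k k' hk ((hp'.1.1 k).lt_of_ne' hne))
    (fun k k' hk hne => hq'.2 k k' hk ((hq'.1.1 k).lt_of_ne' hne))
    (by rw [map_smul, map_add, ← smul_add, ← smul_add, hT, smul_zero])
  refine ⟨z, hz, hzle.trans ?_⟩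
  rw [mul_assoc]
  gcongr
  exact Finset.single_le_sum (f := fun P : Set K × Set K => κ P.1 P.2) (fun _ _ => hκ _ _)
    (Finset.mem_univ ({k | x k = 0}, {k | y k = 0}))

end FiberSimplex

/-! ### First-order optimality, quadratic gradients, strong monotonicity -/

section Calculus

variable {E : Type*} [NormedAddCommGroup E] [InnerProductSpace ℝ E] [CompleteSpace E]

lemma neg_gradient_mem_normalCone {C : Set E} (hC : Convex ℝ C) {φ : E → ℝ} {x g : E}
    (hx : x ∈ C) (hmin : IsMinOn φ C x) (hg : HasGradientAt φ g x) : -g ∈ normalCone C x := by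
  refine ⟨hx, fun y hy => ?_⟩
  have h := hmin.localize.hasFDerivWithinAt_nonneg hg.hasFDerivAt.hasFDerivWithinAt
    (sub_mem_posTangentConeAt_of_segment_subset (hC.segment_subset hx hy))
  rw [InnerProductSpace.toDual_apply_apply] at h
  rw [inner_neg_left]
  linarith

lemma hasGradientAt_inner_self (S : E →L[ℝ] E) (x : E) :
    HasGradientAt (fun x => inner ℝ (S x) x) ((S + ContinuousLinearMap.adjoint S) x) x := by
  rw [hasGradientAt_iff_hasFDerivAt]
  refine (S.hasFDerivAt.inner ℝ (hasFDerivAt_id x)).congr_fderiv ?_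
  ext v
  simp [fderivInnerCLM_apply, ContinuousLinearMap.adjoint_inner_left, real_inner_comm]

lemma hasGradientAt_norm_sub_sq (x y : E) :
    HasGradientAt (fun x => ‖x - y‖ ^ 2) ((2 : ℝ) • (x - y)) x := by
  rw [hasGradientAt_iff_hasFDerivAt]
  refine ((hasFDerivAt_id x).sub_const y).norm_sq.congr_fderiv ?_
  ext v
  simp [two_smul]

lemma _root_.HasGradientAt.add_real {f g : E → ℝ} {f' g' x : E} (hf : HasGradientAt f f' x)
    (hg : HasGradientAt g g' x) : HasGradientAt (fun x => f x + g x) (f' + g') x := by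
  rw [hasGradientAt_iff_hasFDerivAt, map_add]
  exact hf.hasFDerivAt.add hg.hasFDerivAt

lemma _root_.HasGradientAt.const_mul_real {f : E → ℝ} {f' x : E} (hf : HasGradientAt f f' x)
    (c : ℝ) : HasGradientAt (fun x => c * f x) (c • f') x := by
  rw [hasGradientAt_iff_hasFDerivAt, map_smul]
  exact hf.hasFDerivAt.const_mul c

lemma _root_.StrongConvexOn.le_sub_of_hasGradientAt {s : Set E} {σ : ℝ} {h : E → ℝ}
    (hs : StrongConvexOn s σ h) {x y g : E} (hx : x ∈ s) (hy : y ∈ s) (hg : HasGradientAt h g x) :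
    inner ℝ g (y - x) + σ / 2 * ‖y - x‖ ^ 2 ≤ h y - h x := by
  have hline : HasDerivAt (fun t : ℝ => h (x + t • (y - x))) (inner ℝ g (y - x)) 0 := by
    have h0 : HasDerivAt (fun t : ℝ => x + t • (y - x)) (y - x) 0 := by
      simpa using ((hasDerivAt_id (0 : ℝ)).smul_const (y - x)).const_add x
    have h1 : HasFDerivAt h (InnerProductSpace.toDual ℝ E g) (x + (0 : ℝ) • (y - x)) := by
      simpa using hg.hasFDerivAt
    have h2 := h1.comp_hasDerivAt (0 : ℝ) h0
    rwa [InnerProductSpace.toDual_apply_apply] at h2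
  -- Strong convexity bounds the difference quotient on the segment by the expression in `hlim2`;
  -- let `t` decrease to `0`.
  have hlim := hline.tendsto_slope_zero_right
  have hlim2 : Filter.Tendsto (fun t : ℝ => h y - h x - (1 - t) * (σ / 2 * ‖y - x‖ ^ 2))
      (𝓝[>] 0) (𝓝 (h y - h x - (1 - 0) * (σ / 2 * ‖y - x‖ ^ 2))) :=
    (Continuous.tendsto (by fun_prop) 0).mono_left nhdsWithin_le_nhds
  have := le_of_tendsto_of_tendsto hlim hlim2 (by
    filter_upwards [Ioo_mem_nhdsGT (one_pos : (0 : ℝ) < 1)] with t ht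
    have h1 := hs.2 hx hy (sub_nonneg.mpr ht.2.le) ht.1.le (sub_add_cancel 1 t)
    have h2 : (1 - t) • x + t • y = x + t • (y - x) := by module
    rw [h2, norm_sub_rev x y] at h1
    simp only [smul_eq_mul] at h1
    rw [zero_add, zero_smul, add_zero, smul_eq_mul, inv_mul_le_iff₀ ht.1]
    nlinarith)
  linarith

/-- Strong convexity makes the gradient strongly monotone. -/
lemma _root_.StrongConvexOn.le_inner_gradient_sub {s : Set E} {σ : ℝ} {h : E → ℝ}
    (hs : StrongConvexOn s σ h) {x y : E} (hx : x ∈ s) (hy : y ∈ s)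
    (hdx : DifferentiableAt ℝ h x) (hdy : DifferentiableAt ℝ h y) :
    σ * ‖x - y‖ ^ 2 ≤ inner ℝ (gradient h x - gradient h y) (x - y) := by
  have h1 := hs.le_sub_of_hasGradientAt hx hy hdx.hasGradientAt
  have h2 := hs.le_sub_of_hasGradientAt hy hx hdy.hasGradientAt
  rw [← neg_sub x y, norm_neg, inner_neg_right] at h1
  rw [inner_sub_left]
  linarith

end Calculus

/-! ### Existence of critical points and global error bounds -/

section FiberSimplex

variable {K ι ι' : Type} [Fintype K] [DecidableEq ι] [DecidableEq ι'] [Finite ι] [Finite ι']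

/-- Existence of critical points, by a quadratic penalty on the difference of two copies of the
variable. -/
lemma criticalPoints_nonempty (r : K → ι) (s : K → ι') (μ : ι → ℝ) (ν : ι' → ℝ)
    (hne : (fiberSimplex r μ ∩ fiberSimplex s ν).Nonempty)
    (S : EuclideanSpace ℝ K →L[ℝ] EuclideanSpace ℝ K) :
    (criticalPoints r s μ ν (S + ContinuousLinearMap.adjoint S)).Nonempty := by
  obtain ⟨δ, κ, hδ, -, H⟩ :=
    exists_critical_near r s μ ν (S + ContinuousLinearMap.adjoint S)
  obtain ⟨z₀, hz₀, hz₀'⟩ := hne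
  set f : EuclideanSpace ℝ K → ℝ := fun x => inner ℝ (S x) x with hf
  have hfc : Continuous f := by fun_prop
  have hfg : ∀ x, HasGradientAt f ((S + ContinuousLinearMap.adjoint S) x) x :=
    hasGradientAt_inner_self S
  obtain ⟨x₀, -, hx₀⟩ := (isCompact_fiberSimplex r μ).exists_isMinOn ⟨z₀, hz₀⟩ hfc.continuousOn
  obtain ⟨y₀, -, hy₀⟩ := (isCompact_fiberSimplex s ν).exists_isMinOn ⟨z₀, hz₀'⟩ hfc.continuousOn
  have hx₀z : f x₀ ≤ f z₀ := hx₀ hz₀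
  have hy₀z : f y₀ ≤ f z₀ := hy₀ hz₀'
  -- With this weight, `‖x - y‖ ≥ δ` would make the penalized value exceed that of the feasible pair
  -- `(z₀, z₀)`.
  set k : ℝ := (f z₀ + f z₀ - f x₀ - f y₀ + 1) / δ ^ 2 with hk
  have hk0 : 0 < k := div_pos (by linarith) (by positivity)
  obtain ⟨⟨x, y⟩, ⟨hx, hy⟩, hmin⟩ :=
    ((isCompact_fiberSimplex r μ).prod (isCompact_fiberSimplex s ν)).exists_isMinOn
      (f := fun z => f z.1 + f z.2 + k * ‖z.1 - z.2‖ ^ 2) ⟨(z₀, z₀), hz₀, hz₀'⟩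
      (by fun_prop)
  simp only at hx hy
  have hp := neg_gradient_mem_normalCone (convex_fiberSimplex r μ)
    (φ := fun u => f u + k * ‖u - y‖ ^ 2) hx
    (fun u hu => by
      have h1 : f x + f y + k * ‖x - y‖ ^ 2 ≤ f u + f y + k * ‖u - y‖ ^ 2 :=
        hmin (Set.mk_mem_prod hu hy)
      simp only [Set.mem_ofPred_eq]
      linarith)
    ((hfg x).add_real ((hasGradientAt_norm_sub_sq x y).const_mul_real k))
  have hq := neg_gradient_mem_normalCone (convex_fiberSimplex s ν)
    (φ := fun u => f u + k * ‖u - x‖ ^ 2) hy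
    (fun u hu => by
      have h1 : f x + f y + k * ‖x - y‖ ^ 2 ≤ f x + f u + k * ‖x - u‖ ^ 2 :=
        hmin (Set.mk_mem_prod hx hu)
      rw [norm_sub_rev x y, norm_sub_rev x u] at h1
      simp only [Set.mem_ofPred_eq]
      linarith)
    ((hfg y).add_real ((hasGradientAt_norm_sub_sq y x).const_mul_real k))
  -- The penalty gradients at `x` and `y` are opposite and cancel in the sum.
  obtain ⟨z, hz, -⟩ := H x y _ _ hp hq (by module) (by
    by_contra! hge
    have h1 : f x + f y + k * ‖x - y‖ ^ 2 ≤ f z₀ + f z₀ + k * ‖z₀ - z₀‖ ^ 2 :=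
      hmin (Set.mk_mem_prod hz₀ hz₀')
    have h2 : f x₀ ≤ f x := hx₀ hx
    have h3 : f y₀ ≤ f y := hy₀ hy
    have h4 : k * δ ^ 2 ≤ k * ‖x - y‖ ^ 2 := by gcongr
    rw [hk, div_mul_cancel₀ _ (by positivity), ← hk] at h4
    simp only [sub_self, norm_zero] at h1
    linarith)
  exact ⟨z, hz⟩

/-- The error bound of `exists_critical_near` without restriction on the distance. -/
lemma exists_critical_errorBound (r : K → ι) (s : K → ι') (μ : ι → ℝ) (ν : ι' → ℝ)
    (T : EuclideanSpace ℝ K →L[ℝ] EuclideanSpace ℝ K) (hne : (criticalPoints r s μ ν T).Nonempty) :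
    ∃ κ : ℝ, 0 ≤ κ ∧ ∀ x y p q : EuclideanSpace ℝ K,
      p ∈ normalCone (fiberSimplex r μ) x → q ∈ normalCone (fiberSimplex s ν) y →
      T x + T y + p + q = 0 →
      ∃ z ∈ criticalPoints r s μ ν T, ‖(1 / 2 : ℝ) • (x + y) - z‖ ≤ κ * ‖x - y‖ := by
  obtain ⟨δ, κ, hδ, hκ, H⟩ := exists_critical_near r s μ ν T
  obtain ⟨z, hz⟩ := hne
  set R := √(∑ k, μ (r k) ^ 2)
  set R' := √(∑ k, ν (s k) ^ 2)
  have hR : 0 ≤ R := Real.sqrt_nonneg _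
  have hR' : 0 ≤ R' := Real.sqrt_nonneg _
  -- When `‖x - y‖ ≥ δ`, any fixed critical point will do: `R + R + R'` bounds its distance to the
  -- midpoint.
  refine ⟨κ + (R + R + R') / δ, by positivity, fun x y p q hp hq hT => ?_⟩
  rw [add_mul]
  rcases lt_or_ge ‖x - y‖ δ with h | h
  · obtain ⟨z, hz, hle⟩ := H x y p q hp hq hT h
    exact ⟨z, hz, hle.trans (le_add_of_nonneg_right (by positivity))⟩
  · refine ⟨z, hz, ?_⟩
    have hzR : ‖z‖ ≤ R := by
      obtain ⟨p, hp, -⟩ := hz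
      exact norm_le_of_mem_fiberSimplex hp.1
    have hxR : ‖x‖ ≤ R := norm_le_of_mem_fiberSimplex hp.1
    have hyR : ‖y‖ ≤ R' := norm_le_of_mem_fiberSimplex hq.1
    have h1 : ‖(1 / 2 : ℝ) • (x + y) - z‖ ≤ R + R + R' := by
      refine (norm_sub_le _ _).trans ?_
      rw [norm_smul, Real.norm_of_nonneg one_half_pos.le]
      linarith [norm_add_le x y, norm_nonneg (x + y)]
    have h2 : R + R + R' ≤ (R + R + R') / δ * ‖x - y‖ := by
      rw [div_mul_eq_mul_div, le_div_iff₀ hδ]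
      gcongr
    linarith [mul_nonneg hκ (norm_nonneg (x - y))]

/-- Any two points of the products of simplices are close to the intersection, relative to their
distance. -/
lemma exists_inter_errorBound (r : K → ι) (s : K → ι') (μ : ι → ℝ) (ν : ι' → ℝ)
    (hne : (fiberSimplex r μ ∩ fiberSimplex s ν).Nonempty) :
    ∃ κ : ℝ, 0 ≤ κ ∧ ∀ x ∈ fiberSimplex r μ, ∀ y ∈ fiberSimplex s ν,
      ∃ z ∈ fiberSimplex r μ ∩ fiberSimplex s ν, ‖z - x‖ + ‖z - y‖ ≤ κ * ‖x - y‖ := by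
  have zero_mem : ∀ {C : Set (EuclideanSpace ℝ K)} {x}, x ∈ C → 0 ∈ normalCone C x :=
    fun hx => ⟨hx, fun y _ => by simp⟩
  -- For `T = 0` the critical points are exactly the intersection, since zero multipliers are
  -- admissible.
  obtain ⟨κ, hκ, H⟩ := exists_critical_errorBound r s μ ν 0 <| by
    obtain ⟨z, hz, hz'⟩ := hne
    exact ⟨z, 0, zero_mem hz, 0, zero_mem hz', by simp⟩
  refine ⟨2 * κ + 1, by positivity, fun x hx y hy => ?_⟩
  obtain ⟨z, ⟨p, hp, q, hq, -⟩, hle⟩ := H x y 0 0 (zero_mem hx) (zero_mem hy) (by simp)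
  refine ⟨z, ⟨hp.1, hq.1⟩, ?_⟩
  have half : ∀ v : EuclideanSpace ℝ K, ‖(1 / 2 : ℝ) • v‖ = 1 / 2 * ‖v‖ := fun v => by
    rw [norm_smul, Real.norm_of_nonneg one_half_pos.le]
  have h1 : z - x = -((1 / 2 : ℝ) • (x + y) - z) - (1 / 2 : ℝ) • (x - y) := by module
  have h2 : z - y = -((1 / 2 : ℝ) • (x + y) - z) + (1 / 2 : ℝ) • (x - y) := by module
  have h3 := norm_sub_le (-((1 / 2 : ℝ) • (x + y) - z)) ((1 / 2 : ℝ) • (x - y))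
  have h4 := norm_add_le (-((1 / 2 : ℝ) • (x + y) - z)) ((1 / 2 : ℝ) • (x - y))
  rw [← h1, norm_neg, half] at h3
  rw [← h2, norm_neg, half] at h4
  linarith

/-- A strongly monotone coupling with weight `ρ` forces the two points to be `O(1/ρ)`-close. -/
lemma exists_norm_sub_le (r : K → ι) (s : K → ι') (μ : ι → ℝ) (ν : ι' → ℝ)
    (hne : (fiberSimplex r μ ∩ fiberSimplex s ν).Nonempty)
    (T : EuclideanSpace ℝ K →L[ℝ] EuclideanSpace ℝ K) {σ : ℝ} (hσ : 0 < σ) :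
    ∃ τ : ℝ, 0 < τ ∧ ∀ (x y p q v : EuclideanSpace ℝ K) (ρ : ℝ), 0 < ρ →
      p ∈ normalCone (fiberSimplex r μ) x → q ∈ normalCone (fiberSimplex s ν) y →
      T y + ρ • v + p = 0 → T x - ρ • v + q = 0 → σ * ‖x - y‖ ^ 2 ≤ inner ℝ v (x - y) →
      ‖x - y‖ ≤ τ / ρ := by
  obtain ⟨κ, hκ, H⟩ := exists_inter_errorBound r s μ ν hne
  set R := √(∑ k, μ (r k) ^ 2)
  set R' := √(∑ k, ν (s k) ^ 2)
  have hR : 0 ≤ R := Real.sqrt_nonneg _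
  have hR' : 0 ≤ R' := Real.sqrt_nonneg _
  refine ⟨(‖T‖ * (R + R') * κ + 1) / σ, by positivity, fun x y p q v ρ hρ hp hq hTp hTq hv => ?_⟩
  obtain ⟨z, ⟨hz, hz'⟩, hle⟩ := H x hp.1 y hq.1
  have h1 := hp.2 z hz
  have h2 := hq.2 z hz'
  rw [← neg_eq_of_add_eq_zero_right hTp, inner_neg_left, inner_add_left, real_inner_smul_left] at h1
  rw [← neg_eq_of_add_eq_zero_right hTq, inner_neg_left, inner_sub_left, real_inner_smul_left] at h2
  have h3 : inner ℝ v (z - y) - inner ℝ v (z - x) = inner ℝ v (x - y) := by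
    rw [← inner_sub_right, sub_sub_sub_cancel_left]
  have hbound : ∀ a b : EuclideanSpace ℝ K, ‖a‖ ≤ R + R' →
      inner ℝ (T a) b ≤ ‖T‖ * (R + R') * ‖b‖ := fun a b ha =>
    (real_inner_le_norm _ _).trans (by
      gcongr
      exact (T.le_opNorm a).trans (by gcongr))
  have h4 := hbound y (z - x) (by linarith [norm_le_of_mem_fiberSimplex hq.1])
  have h5 := hbound x (z - y) (by linarith [norm_le_of_mem_fiberSimplex hp.1])
  -- Adding `h1` and `h2`, the terms in `v` combine by `h3` into `ρ * ⟪v, x - y⟫`, and `z` survives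
  -- only in the terms bounded by `h4` and `h5`.
  have h6 : ρ * inner ℝ v (x - y) ≤ ‖T‖ * (R + R') * κ * ‖x - y‖ := by
    have := mul_le_mul_of_nonneg_left hle (by positivity : 0 ≤ ‖T‖ * (R + R'))
    rw [← h3]
    linarith
  have h7 : ρ * (σ * ‖x - y‖ ^ 2) ≤ ‖T‖ * (R + R') * κ * ‖x - y‖ :=
    (mul_le_mul_of_nonneg_left hv hρ.le).trans h6
  rw [div_div, le_div_iff₀ (by positivity)]
  rcases (norm_nonneg (x - y)).eq_or_lt with h0 | h0
  · rw [← h0, zero_mul]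
    positivity
  · refine le_of_mul_le_mul_right ?_ h0
    nlinarith

end FiberSimplex

/-! ### Translation from matrices to coordinates -/

section Bridge

variable {n m : ℕ}

lemma C₁_eq_fiberSimplex (μ : Fin n → ℝ) :
    (C₁ μ : Set (MatSpace n m)) = fiberSimplex Prod.fst μ := by
  ext x
  refine and_congr (by simp [toMat]) ?_
  rw [funext_iff]
  refine forall_congr' fun i => ?_
  rw [show ∑ k : Fin n × Fin m with k.1 = i, x k = (toMat x *ᵥ 1) i by
    simp [Finset.sum_filter, Fintype.sum_prod_type, Matrix.mulVec, dotProduct, toMat]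
    rw [Finset.sum_comm]
    simp]

lemma C₂_eq_fiberSimplex (ν : Fin m → ℝ) :
    (C₂ ν : Set (MatSpace n m)) = fiberSimplex Prod.snd ν := by
  ext x
  refine and_congr (by simp [toMat]) ?_
  rw [funext_iff]
  refine forall_congr' fun j => ?_
  rw [show ∑ k : Fin n × Fin m with k.2 = j, x k = ((toMat x)ᵀ *ᵥ 1) j by
    simp [Finset.sum_filter, Fintype.sum_prod_type_right, Matrix.mulVec, dotProduct, toMat]
    rw [Finset.sum_comm]
    simp]

lemma inter_nonempty {μ : Fin n → ℝ} {ν : Fin m → ℝ} (hμ : μ ∈ stdSimplex ℝ (Fin n))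
    (hν : ν ∈ stdSimplex ℝ (Fin m)) :
    (fiberSimplex (K := Fin n × Fin m) Prod.fst μ ∩ fiberSimplex Prod.snd ν).Nonempty := by
  refine ⟨WithLp.toLp 2 fun k => μ k.1 * ν k.2, ⟨fun k => mul_nonneg (hμ.1 _) (hν.1 _),
    fun i => ?_⟩, ⟨fun k => mul_nonneg (hμ.1 _) (hν.1 _), fun j => ?_⟩⟩
  · simp [Finset.sum_filter, Fintype.sum_prod_type, ← Finset.mul_sum, hν.2]
  · simp [Finset.sum_filter, Fintype.sum_prod_type_right, ← Finset.sum_mul, hμ.2]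

lemma exists_gwObjective_eq (DX : Matrix (Fin n) (Fin n) ℝ) (DY : Matrix (Fin m) (Fin m) ℝ) :
    ∃ S : MatSpace n m →L[ℝ] MatSpace n m, gwObjective DX DY = fun x => inner ℝ (S x) x := by
  let S : MatSpace n m →ₗ[ℝ] MatSpace n m := IsLinearMap.mk'
    (fun x => WithLp.toLp 2 fun k => -(DX * toMat x * DY) k.1 k.2)
    { map_add := fun x y => by
        have : toMat (x + y) = toMat x + toMat y := rfl
        ext k
        simp [this, Matrix.mul_add, Matrix.add_mul, add_comm]
      map_smul := fun c x => by
        have : toMat (c • x) = c • toMat x := rfl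
        ext k
        simp [this] }
  refine ⟨LinearMap.toContinuousLinearMap S, funext fun x => ?_⟩
  have hS : ∀ k, S x k = -(DX * toMat x * DY) k.1 k.2 := fun _ => rfl
  simp only [LinearMap.coe_toContinuousLinearMap', PiLp.inner_apply, hS, gwObjective, Matrix.trace,
    Fintype.sum_prod_type, ← Finset.sum_neg_distrib, Matrix.diag_apply]
  refine Finset.sum_congr rfl fun i _ => ?_
  rw [Matrix.mul_apply, ← Finset.sum_neg_distrib]
  refine Finset.sum_congr rfl fun j _ => ?_
  simp [toMat, mul_comm]

/-- Feasibility is automatic on the right, because a normal cone is empty outside its set. -/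
lemma criticalSet_eq_criticalPoints {DX : Matrix (Fin n) (Fin n) ℝ}
    {DY : Matrix (Fin m) (Fin m) ℝ} {T : MatSpace n m →L[ℝ] MatSpace n m}
    (hT : ∀ x, gradient (gwObjective DX DY) x = T x) (μ : Fin n → ℝ) (ν : Fin m → ℝ) :
    criticalSet DX DY μ ν = criticalPoints Prod.fst Prod.snd μ ν T := by
  ext x
  simp only [criticalSet, criticalPoints, Set.mem_ofPred_eq, hT, C₁_eq_fiberSimplex,
    C₂_eq_fiberSimplex]
  exact ⟨fun h => h.2, fun h => ⟨⟨h.choose_spec.1.1, h.choose_spec.2.choose_spec.1.1⟩, h⟩⟩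

end Bridge

end GromovWasserstein

/-! ### The error bound for fixed points -/

open GromovWasserstein in
theorem proposition3 {n m : ℕ}
    (DX : Matrix (Fin n) (Fin n) ℝ) (DY : Matrix (Fin m) (Fin m) ℝ)
    (hDX : DX.IsSymm) (hDY : DY.IsSymm)
    (μ : Fin n → ℝ) (ν : Fin m → ℝ)
    (hμ : μ ∈ stdSimplex ℝ (Fin n)) (hν : ν ∈ stdSimplex ℝ (Fin m))
    (σ : ℝ) (hσ : 0 < σ) :
    (GromovWasserstein.criticalSet DX DY μ ν).Nonempty ∧
    ∃ τ₁ τ₂ : ℝ, 0 < τ₁ ∧ 0 < τ₂ ∧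
      ∀ (D : Set (GromovWasserstein.MatSpace n m)) (h : GromovWasserstein.MatSpace n m → ℝ),
        GromovWasserstein.IsLegendre D h →
        StrongConvexOn
          (interior D ∩ convexHull ℝ (GromovWasserstein.C₁ μ ∪ GromovWasserstein.C₂ ν)) σ h →
        ∀ ρ : ℝ, 0 < ρ →
          ∀ π w : GromovWasserstein.MatSpace n m,
            (π, w) ∈ GromovWasserstein.bapgFixedPoints DX DY μ ν D h ρ →
            ‖π - w‖ ≤ τ₁ / ρ ∧
            Metric.infDist ((1 / 2 : ℝ) • (π + w)) (GromovWasserstein.criticalSet DX DY μ ν)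
              ≤ τ₂ / ρ := by
  obtain ⟨S, hS⟩ := exists_gwObjective_eq DX DY
  set T := S + ContinuousLinearMap.adjoint S
  have hT : ∀ x, gradient (gwObjective DX DY) x = T x := fun x => by
    rw [hS]
    exact (hasGradientAt_inner_self S x).gradient
  have hne := inter_nonempty hμ hν
  have hcrit := criticalPoints_nonempty Prod.fst Prod.snd μ ν hne S
  obtain ⟨τ, hτ, H₁⟩ := exists_norm_sub_le Prod.fst Prod.snd μ ν hne T hσ
  obtain ⟨κ, hκ, H₂⟩ := exists_critical_errorBound Prod.fst Prod.snd μ ν T hcrit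
  rw [criticalSet_eq_criticalPoints hT]
  -- Since `κ` may be zero, `κ + 1` keeps the second constant positive.
  refine ⟨hcrit, τ, (κ + 1) * τ, hτ, by positivity, fun D h hL hsc ρ hρ x y hxy => ?_⟩
  obtain ⟨hxD, hyD, p, hp, q, hq, hep, heq⟩ := hxy
  simp only [hT] at hxD hyD hep heq hp hq
  rw [C₁_eq_fiberSimplex] at hp
  rw [C₂_eq_fiberSimplex] at hq
  have hmono := hsc.le_inner_gradient_sub (x := x) (y := y)
    ⟨hxD, subset_convexHull ℝ _ (Or.inl (C₁_eq_fiberSimplex μ ▸ hp.1))⟩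
    ⟨hyD, subset_convexHull ℝ _ (Or.inr (C₂_eq_fiberSimplex ν ▸ hq.1))⟩
    (hL.differentiableAt x hxD) (hL.differentiableAt y hyD)
  have hdist := H₁ x y p q _ ρ hρ hp hq hep (by rw [← heq]; module) hmono
  refine ⟨hdist, ?_⟩
  -- The sum of the two fixed-point equations no longer involves `h` or `ρ`.
  obtain ⟨z, hz, hle⟩ := H₂ x y p q hp hq <| by
    rw [← add_zero (0 : MatSpace n m)]
    nth_rewrite 1 [← hep]
    rw [← heq]
    module
  refine (Metric.infDist_le_dist_of_mem hz).trans ?_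
  rw [dist_eq_norm]
  refine hle.trans ((mul_le_mul_of_nonneg_left hdist hκ).trans ?_)
  rw [← mul_div_assoc]
  gcongr
  linarith
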